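/- Let $T$ be a complete dependent (NIP) first-order theory in a language $\tau$, put $|T| = |\tau| + \aleph_0$, and let $\kappa > |T|$ be a cardinal. Let $\mathfrak C$ be a monster model of $T$, that is, a $\bar\kappa$-saturated model for a large infinite cardinal $\bar\kappa$; let $N \prec \mathfrak C$ with $|N| < \bar\kappa$, and let $A \subseteq \mathfrak C$. Types and realizations are computed in $\mathfrak C$. A complete type $p(\bar x)$ over a set $B$ *does not split* over $D \subseteq B$ if $\varphi(\bar x, \bar b) \in p$ and $\neg\varphi(\bar x, \bar c) \in p$, with $\bar b, \bar c$ finite tuples from $B$, imply $\operatorname{tp}(\bar b, D) \ne \operatorname{tp}(\bar c, D)$. Complete types $p(\bar x), q(\bar y)$ over $B$ are *weakly orthogonal* if $\operatorname{tp}(\bar a_1\bar b_1, B) = \operatorname{tp}(\bar a_2 \bar b_2, B)$ whenever $\bar a_1, \bar a_2$ realize $p$ and $\bar b_1, \bar b_2$ realize $q$. Let $N_{[A]}$ be the expansion of $N$ by the relations $$R_{\varphi(\bar x, \bar a)} = \{\bar b \in N^{\ell g(\bar x)} : \mathfrak C \models \varphi[\bar b, \bar a]\},$$ one for each $\tau$-formula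 $\varphi(\bar x, \bar y)$ with $\bar x$, $\bar y$ finite and each tuple $\bar a$ from $A$ of length $\ell g(\bar y)$. Assume that (a) $N$ is $\kappa$-saturated; (b) $|A| < \kappa$; (c) for every finite tuple $\bar a$ from $A$, $\operatorname{tp}(\bar a, N)$ is weakly orthogonal to every complete type over $N$ in finitely many variables that does not split over some subset of $N$ of cardinality $< \kappa$; (d) $N_{[A]}$ has elimination of quantifiers: every formula in the language of $N_{[A]}$ is equivalent in $N_{[A]}$ to a quantifier-free formula with the same free variables. Then $N_{[A]}$ is $\kappa$-saturated. -/

import Mathlib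

open FirstOrder Cardinal

universe u v w w'

namespace ExternalExpansion

open FirstOrder.Language

section Types

variable {L : FirstOrder.Language.{u, v}} {M : Type w} [L.Structure M] {α β : Type w'}

/-- The space of complete types over the parameter set `B ⊆ M` in variables indexed by `α`:
the maximal sets of formulas with parameters in `B` consistent with the complete theory of `M`
with the elements of `B` named. -/
abbrev TypesOver (L : FirstOrder.Language.{u, v}) {M : Type w} [L.Structure M] (B : Set M) (α : Type w') :
    Type (max u v w w') :=
  (L[[B]].completeTheory M).CompleteType α

/-- The tuple `a` of `M` realizes the type `p` over `B`. -/
def Realizes {B : Set M} (a : α → M) (p : TypesOver L B α) : Prop :=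
  ∀ φ : L[[B]].Formula α, Formula.equivSentence φ ∈ p ↔ φ.Realize a

/-- `tp(a, B, M)`: the complete type over `B` of the tuple `a` in the structure `M`. -/
noncomputable def tp (L : FirstOrder.Language.{u, v}) {M : Type w} [L.Structure M] [Nonempty M]
    (B : Set M) (a : α → M) : TypesOver L B α :=
  (L[[B]].completeTheory M).typeOf a

/-- `M` is `κ`-saturated: every complete 1-type over a subset of `M` of cardinality `< κ`
is realized in `M`. -/
def IsSaturated (L : FirstOrder.Language.{u, v}) (κ : Cardinal.{w}) (M : Type w) [L.Structure M] : Prop :=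
  ∀ B : Set M, #B < κ → ∀ p : TypesOver L B (Fin 1), ∃ a : Fin 1 → M, Realizes a p

/-- The formula `φ(x, b)` obtained from `φ(x, y)` by substituting parameters `b` from `B`
for the variables `y`. -/
def withParams {B : Set M} {m : ℕ} (φ : L.Formula (α ⊕ Fin m)) (b : Fin m → B) :
    L[[B]].Formula α :=
  BoundedFormula.constantsVarsEquiv.symm
    (Formula.relabel (Sum.elim (Sum.inr : α → B ⊕ α) (fun i => Sum.inl (b i))) φ)

/-- `p` does not split over `D`: if `φ(x, b)` and `¬ φ(x, c)` are in `p`, then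
`tp(b, D) ≠ tp(c, D)`. -/
def DoesNotSplitOver [Nonempty M] {B : Set M} (p : TypesOver L B α) (D : Set M) : Prop :=
  ∀ (m : ℕ) (φ : L.Formula (α ⊕ Fin m)) (b c : Fin m → B),
    Formula.equivSentence (withParams φ b) ∈ p →
    Formula.equivSentence (withParams φ c).not ∈ p →
    tp L D (fun i => (b i : M)) ≠ tp L D (fun i => (c i : M))

/-- Weak orthogonality of two complete types over `B`. Realizations range over the ambient
structure `M`, which is the monster model when this is used. -/
def WeaklyOrthogonal [Nonempty M] {B : Set M} (p : TypesOver L B α) (q : TypesOver L B β) :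
    Prop :=
  ∀ (a₁ a₂ : α → M) (b₁ b₂ : β → M),
    Realizes a₁ p → Realizes a₂ p → Realizes b₁ q → Realizes b₂ q →
      tp L B (Sum.elim a₁ b₁) = tp L B (Sum.elim a₂ b₂)

/-- The complete types over `B` which do not split over some subset of `B` of
cardinality `< κ`. -/
def nspLT (L : FirstOrder.Language.{u, v}) {M : Type w} [L.Structure M] [Nonempty M]
    (κ : Cardinal.{w}) (B : Set M)
    (α : Type w') : Set (TypesOver L B α) :=
  {p | ∃ D : Set M, D ⊆ B ∧ #D < κ ∧ DoesNotSplitOver p D}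

/-- The complete types over `B` which are weakly orthogonal to every complete type over `B` in
finitely many variables that does not split over some subset of `B` of cardinality `< κ`. -/
def nspGE (L : FirstOrder.Language.{u, v}) {M : Type w} [L.Structure M] [Nonempty M]
    (κ : Cardinal.{w}) (B : Set M)
    (α : Type) : Set (TypesOver L B α) :=
  {p | ∀ (m : ℕ), ∀ r ∈ nspLT L κ B (Fin m), WeaklyOrthogonal p r}

end Types

/-- `T` is dependent: no formula `φ(x, y)` has the independence property in a model of `T`.
(A formula having it in some model has it in a model of cardinality at most
`|L| + 2^ℵ₀`, so the universe of the models here is no restriction.) -/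
def IsDependent {L : FirstOrder.Language.{u, v}} (T : L.Theory) : Prop :=
  ¬ ∃ (k l : ℕ) (φ : L.Formula (Fin k ⊕ Fin l)) (M : Theory.ModelType.{u, v, max u v} T)
      (a : Set ℕ → Fin k → M) (b : ℕ → Fin l → M),
      ∀ (s : Set ℕ) (n : ℕ), n ∈ s ↔ φ.Realize (Sum.elim (a s) (b n))

/-- The complete theory of the structure `M` has elimination of quantifiers. -/
def HasQuantifierElimination (L : FirstOrder.Language.{u, v}) (M : Type w) [L.Structure M] : Prop :=
  ∀ (n : ℕ) (φ : L.Formula (Fin n)), ∃ ψ : L.Formula (Fin n),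
    ψ.IsQF ∧ ∀ x : Fin n → M, φ.Realize x ↔ ψ.Realize x

/-- The new relation symbols of the expansion `N_[A]`: an `n`-ary symbol for every formula
`φ(x, a)` with parameters `a` from `A` and `n` free variables `x`. A formula with parameters
from `A` is a formula with variables from `A ⊕ Fin n`. -/
def traceLanguage (L : FirstOrder.Language.{u, v}) {C : Type w} (A : Set C) :
    FirstOrder.Language.{0, max u v w} where
  Functions := fun _ => PEmpty
  Relations := fun n => L.Formula (A ⊕ Fin n)

/-- The symbol of `φ(x, a)` is interpreted in `N` as the trace on `N` of the set which
`φ(x, a)` defines in `C`. -/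
instance traceStructure {L : FirstOrder.Language.{u, v}} {C : Type w} [L.Structure C]
    (N : L.ElementarySubstructure C) (A : Set C) : (traceLanguage L A).Structure N where
  funMap := fun f => f.elim
  RelMap := fun {n} (φ : L.Formula (A ⊕ Fin n)) x =>
    φ.Realize (Sum.elim (fun a : A => (a : C)) (fun i => ((x i : N) : C)))

/-- The language of `N_[A]`; the structure on `N` is the one that Mathlib puts on a sum of two
languages, from the structure of `N` as a substructure of `C` and `traceStructure N A`. -/
abbrev expansionLanguage (L : FirstOrder.Language.{u, v}) {C : Type w} (A : Set C) :
    FirstOrder.Language.{u, max u v w} :=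
  L.sum (traceLanguage L A)

end ExternalExpansion

/-! By quantifier elimination, a 1-type p of N_[A] over a small B is a set P of traces φ(x, b, a),
with φ a τ-formula, b in B and a in A, and |P| < κ. Choose a witness in N for each φ ∈ P. Since P is
closed under conjunction, these witnesses, with an ultrafilter on the finite subsets of P, give a
limit type q over N that is finitely satisfiable in a set D ⊆ N of size < κ. Hence q does not split
over D (`doesNotSplitOver_tp_of_eventually`), so q is weakly orthogonal to tp(a, N). By compactness
in the monster, φ(x, b, a) then follows from a single θ_φ(x) ∈ q with parameters in N
(`exists_formula_imp_of_eventually`). All the θ_φ together use fewer than κ parameters, so the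
saturation of N realizes them at once, and any realization satisfies p. -/

namespace ExternalExpansion

open FirstOrder.Language Filter

/-! ### Parameters, types and saturation. -/

section Formulas

variable {L : FirstOrder.Language.{u, v}} {M : Type w} [L.Structure M]

/-- Only finitely many of the variables in a chosen block occur in a formula. -/
theorem exists_finite_variables {α β : Type*} (φ : L.Formula (α ⊕ β)) :
    ∃ (n : ℕ) (f : Fin n → α) (ψ : L.Formula (Fin n ⊕ β)),
      ∀ (v : α → M) (x : β → M),
        φ.Realize (Sum.elim v x) ↔ ψ.Realize (Sum.elim (v ∘ f) x) := by
  classical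
  let s : Set α := {a | Sum.inl a ∈ φ.freeVarFinset}
  have hs : s.Finite :=
    φ.freeVarFinset.finite_toSet.preimage (Sum.inl_injective.injOn)
  have : Finite s := hs
  obtain ⟨n, ⟨e⟩⟩ := Finite.exists_equiv_fin s
  let g : φ.freeVarFinset → Fin n ⊕ β := fun z =>
    match z with
    | ⟨Sum.inl a, h⟩ => Sum.inl (e ⟨a, h⟩)
    | ⟨Sum.inr b, _⟩ => Sum.inr b
  refine ⟨n, fun i => (e.symm i : α), BoundedFormula.restrictFreeVar φ g, fun v x => ?_⟩
  refine (BoundedFormula.realize_restrictFreeVar (Sum.elim v x) ?_).symm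
  rintro ⟨a | b, h⟩
  · simp [g]
  · simp [g]

/-- Reading the parameters of a formula as variables. -/
theorem realize_constantsVarsEquiv_iff {α : Type*} {B : Set M} (φ : L[[B]].Formula α) (x : α → M) :
    Formula.Realize (L := L) (BoundedFormula.constantsVarsEquiv φ)
      (Sum.elim (fun b : B => (b : M)) x) ↔ φ.Realize x := by
  have := BoundedFormula.realize_constantsVarsEquiv (φ := φ) (v := x) (xs := (default : Fin 0 → M))
  simpa [Formula.Realize] using this

/-- Reading some of the variables of a formula as parameters. -/
theorem realize_constantsVarsEquiv_symm_iff {α : Type*} {B : Set M} (φ : L.Formula (B ⊕ α))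
    (x : α → M) :
    Formula.Realize (L := L[[B]]) (BoundedFormula.constantsVarsEquiv.symm φ) x ↔
      φ.Realize (Sum.elim (fun b : B => (b : M)) x) := by
  rw [← realize_constantsVarsEquiv_iff, Equiv.apply_symm_apply]

theorem realize_withParams {α : Type*} {B : Set M} {m : ℕ} (φ : L.Formula (α ⊕ Fin m))
    (b : Fin m → B) (x : α → M) :
    (withParams φ b).Realize x ↔ φ.Realize (Sum.elim x fun i => (b i : M)) := by
  rw [withParams, realize_constantsVarsEquiv_symm_iff, Formula.realize_relabel]
  congr! 1
  ext (i | i) <;> rfl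

theorem equivSentence_mem_tp_iff [Nonempty M] {α : Type*} {B : Set M} (x : α → M)
    (φ : L[[B]].Formula α) : Formula.equivSentence φ ∈ tp L B x ↔ φ.Realize x :=
  Theory.CompleteType.formula_mem_typeOf

theorem realizes_tp_iff [Nonempty M] {α : Type*} {B : Set M} (x y : α → M) :
    Realizes y (tp L B x) ↔ tp L B y = tp L B x := by
  simp only [Realizes, equivSentence_mem_tp_iff, SetLike.ext_iff]
  constructor
  · intro h σ
    obtain ⟨φ, rfl⟩ := Formula.equivSentence.surjective σ
    simp only [equivSentence_mem_tp_iff]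
    exact (h φ).symm
  · intro h φ
    simpa only [equivSentence_mem_tp_iff] using (h (Formula.equivSentence φ)).symm

theorem tp_eq_iff [Nonempty M] {α : Type*} {B : Set M} (x y : α → M) :
    tp L B x = tp L B y ↔ ∀ φ : L.Formula (B ⊕ α),
      φ.Realize (Sum.elim (fun b : B => (b : M)) x) ↔
        φ.Realize (Sum.elim (fun b : B => (b : M)) y) := by
  rw [← realizes_tp_iff]
  simp only [Realizes, equivSentence_mem_tp_iff]
  constructor
  · intro h φ
    rw [← realize_constantsVarsEquiv_symm_iff, ← realize_constantsVarsEquiv_symm_iff]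
    exact (h _).symm
  · intro h φ
    rw [← realize_constantsVarsEquiv_iff, ← realize_constantsVarsEquiv_iff]
    exact (h _).symm

/-- A saturated structure realizes every finitely satisfiable set of formulas with few
parameters. -/
theorem IsSaturated.exists_realize {κ : Cardinal.{w}} (h : IsSaturated L κ M) {B : Set M}
    (hB : #B < κ) (Γ : Set (L.Formula (B ⊕ Fin 1)))
    (hΓ : ∀ F : Finset (L.Formula (B ⊕ Fin 1)), (F : Set _) ⊆ Γ →
      ∃ x : Fin 1 → M, ∀ φ ∈ F, φ.Realize (Sum.elim (fun b : B => (b : M)) x)) :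
    ∃ x : Fin 1 → M, ∀ φ ∈ Γ, φ.Realize (Sum.elim (fun b : B => (b : M)) x) := by
  classical
  obtain ⟨x₀, -⟩ := hΓ ∅ (by simp)
  have : Nonempty M := ⟨x₀ 0⟩
  let g : L.Formula (B ⊕ Fin 1) → (L[[B]])[[Fin 1]].Sentence := fun φ =>
    Formula.equivSentence (L := L[[B]]) (BoundedFormula.constantsVarsEquiv.symm φ)
  have hne : ({p : TypesOver L B (Fin 1) | g '' Γ ⊆ p} : Set _).Nonempty := by
    rw [Set.nonempty_iff_ne_empty, Ne, Theory.CompleteType.setOfPred_subset_eq_empty_iff, not_not,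
      Theory.isSatisfiable_iff_isFinitelySatisfiable]
    intro T₀ hT₀
    obtain ⟨F, hF, hFT⟩ : ∃ F : Finset (L.Formula (B ⊕ Fin 1)), (F : Set _) ⊆ Γ ∧
        ∀ σ ∈ T₀, σ ∈ ((L[[B]]).lhomWithConstants (Fin 1)).onTheory (L[[B]].completeTheory M) ∨
          σ ∈ g '' F := by
      obtain ⟨F, hF, hF'⟩ := Finset.subset_set_image_iff.1
        (show ((T₀.filter (· ∈ g '' Γ) : Finset _) : Set _) ⊆ g '' Γ by
          intro σ hσ; exact (Finset.mem_filter.1 hσ).2)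
      refine ⟨F, hF, fun σ hσ => ?_⟩
      rcases hT₀ hσ with h1 | h1
      · exact Or.inl h1
      · right
        have : σ ∈ F.image g := by rw [hF']; exact Finset.mem_filter.2 ⟨hσ, h1⟩
        simpa using this
    obtain ⟨x, hx⟩ := hΓ F hF
    -- The type of the witness `x` contains all of `T₀`, and a type is satisfiable.
    refine (Theory.CompleteType.isMaximal (tp L B x)).1.mono fun σ hσ => ?_
    rcases hFT σ hσ with h1 | ⟨φ, hφ, rfl⟩
    · exact (tp L B x).subset h1
    · exact (equivSentence_mem_tp_iff x _).2
        ((realize_constantsVarsEquiv_symm_iff φ x).2 (hx φ hφ))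
  obtain ⟨p, hp⟩ := hne
  obtain ⟨x, hx⟩ := h B hB p
  refine ⟨x, fun φ hφ => ?_⟩
  rw [← realize_constantsVarsEquiv_symm_iff]
  exact (hx _).1 (hp ⟨φ, hφ, rfl⟩)

/-- In a saturated structure, formulas with few parameters each of which holds eventually along
a family of elements are simultaneously realized. -/
theorem IsSaturated.exists_realize_of_eventually {κ : Cardinal.{w}} (h : IsSaturated L κ M)
    {B : Set M} (hB : #B < κ) {ι : Type*} (l : Filter ι) [l.NeBot] (f : ι → M)
    (Γ : Set (L.Formula (B ⊕ Fin 1)))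
    (hΓ : ∀ φ ∈ Γ, ∀ᶠ i in l, φ.Realize (Sum.elim (fun b : B => (b : M)) fun _ => f i)) :
    ∃ x : Fin 1 → M, ∀ φ ∈ Γ, φ.Realize (Sum.elim (fun b : B => (b : M)) x) := by
  refine h.exists_realize hB Γ fun F hF => ?_
  have : ∀ᶠ i in l, ∀ φ ∈ F, φ.Realize (Sum.elim (fun b : B => (b : M)) fun _ => f i) :=
    (Filter.eventually_all_finset F).2 fun φ hφ => hΓ φ (hF hφ)
  obtain ⟨i, hi⟩ := this.exists
  exact ⟨fun _ => f i, hi⟩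

/-- The assumption κ > |T| makes sets of formulas in few variables small. -/
theorem mk_formula_lt {κ : Cardinal.{w}}
    (hκ : Cardinal.lift.{w} (max ℵ₀ L.card) < Cardinal.lift.{max u v} κ) {α : Type w}
    (hα : #α < κ) : #(L.Formula α) < Cardinal.lift.{max u v} κ := by
  have hℵ : ℵ₀ < Cardinal.lift.{max u v} κ := by
    refine lt_of_le_of_lt ?_ hκ
    rw [← Cardinal.lift_aleph0.{w, max u v}, Cardinal.lift_le]
    exact le_max_left _ _
  have h1 : #(L.Formula α) ≤ #(Σ n, L.BoundedFormula α n) :=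
    Cardinal.mk_le_of_injective (f := fun φ => ⟨0, φ⟩) fun φ ψ h => by simpa using h
  refine (h1.trans BoundedFormula.card_le).trans_lt (max_lt hℵ (Cardinal.add_lt_of_lt hℵ.le ?_ ?_))
  · exact Cardinal.lift_lt.2 hα
  · refine lt_of_le_of_lt ?_ hκ
    exact Cardinal.lift_le.2 (le_max_right _ _)

end Formulas

/-! ### Limit types and weak orthogonality. -/

section Orthogonality

variable {L : FirstOrder.Language.{u, v}} {C : Type w} [L.Structure C] [Nonempty C]

/-- A type which is approximated by elements of `D` does not split over `D`. -/
theorem doesNotSplitOver_tp_of_eventually {B D : Set C} {ι : Type*} (l : Ultrafilter ι)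
    (f : ι → C) (hD : ∀ᶠ i in (l : Filter ι), f i ∈ D) (x : Fin 1 → C)
    (hx : ∀ θ : L.Formula (B ⊕ Fin 1),
      (∀ᶠ i in (l : Filter ι), θ.Realize (Sum.elim (fun b : B => (b : C)) fun _ => f i)) →
        θ.Realize (Sum.elim (fun b : B => (b : C)) x)) :
    DoesNotSplitOver (tp L B x) D := by
  intro m φ b c hb hc heq
  rw [equivSentence_mem_tp_iff, realize_withParams] at hb
  rw [equivSentence_mem_tp_iff, Formula.realize_not, realize_withParams] at hc
  -- Elements of `D` cannot tell `b` from `c`, since `b` and `c` have the same type over `D`.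
  have key : ∀ d : C, d ∈ D → (φ.Realize (Sum.elim (fun _ => d) fun i => (b i : C)) ↔
      φ.Realize (Sum.elim (fun _ => d) fun i => (c i : C))) := by
    intro d hd
    have := (tp_eq_iff _ _).1 heq
      (φ.relabel (Sum.elim (fun _ : Fin 1 => Sum.inl (⟨d, hd⟩ : D)) Sum.inr))
    simp only [Formula.realize_relabel] at this
    convert this using 2 <;> ext (i | i) <;> rfl
  let par : (Fin m → B) → L.Formula (B ⊕ Fin 1) := fun b =>
    φ.relabel (Sum.elim Sum.inr fun i => Sum.inl (b i))
  have hpar : ∀ (b : Fin m → B) (y : Fin 1 → C),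
      (par b).Realize (Sum.elim (fun b : B => (b : C)) y) ↔
        φ.Realize (Sum.elim y fun i => (b i : C)) := by
    intro b y
    rw [Formula.realize_relabel]
    congr! 1
    ext (i | i) <;> rfl
  -- The ultrafilter decides φ(f i, b). If true, `key` moves it to `c` and `x` inherits φ(x, c); if
  -- false, `x` inherits ¬φ(x, b).
  rcases l.eventually_or.1 (Filter.Eventually.of_forall fun i => em
      ((par b).Realize (Sum.elim (fun b : B => (b : C)) fun _ => f i))) with h | h
  · refine hc ((hpar c x).1 (hx _ ?_))
    filter_upwards [h, hD] with i hi hiD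
    rw [hpar] at hi ⊢
    exact (key _ hiD).1 hi
  · have := hx (par b).not (by simpa only [Formula.realize_not] using h)
    rw [Formula.realize_not, hpar] at this
    exact this hb

/-- Weak orthogonality to the types which do not split over small sets: a formula with parameters
in `B ∪ {a₁, …, aₙ}` which holds for almost all elements of a small subset of `B`
follows from such a formula with parameters in `B`. -/
theorem exists_formula_imp_of_eventually {κ κbar : Cardinal.{w}} (hκbar : ℵ₀ ≤ κbar)
    (hC : IsSaturated L κbar C) {B : Set C} (hB : #B < κbar) {n : ℕ} (a : Fin n → C)
    (ha : tp L B a ∈ nspGE L κ B (Fin n)) {D : Set C} (hDB : D ⊆ B) (hDκ : #D < κ)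
    {ι : Type*} (l : Ultrafilter ι) (f : ι → C) (hD : ∀ᶠ i in (l : Filter ι), f i ∈ D)
    (φ : L.Formula (B ⊕ (Fin n ⊕ Fin 1)))
    (hφ : ∀ᶠ i in (l : Filter ι),
      φ.Realize (Sum.elim (fun b : B => (b : C)) (Sum.elim a fun _ => f i))) :
    ∃ θ : L.Formula (B ⊕ Fin 1),
      (∀ᶠ i in (l : Filter ι), θ.Realize (Sum.elim (fun b : B => (b : C)) fun _ => f i)) ∧
      ∀ x : Fin 1 → C, θ.Realize (Sum.elim (fun b : B => (b : C)) x) →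
        φ.Realize (Sum.elim (fun b : B => (b : C)) (Sum.elim a x)) := by
  classical
  by_contra! hcon
  -- With `a` among the parameters, φ(a, x) is a formula in one variable over a set still smaller
  -- than `κbar`.
  let B' : Set C := B ∪ Set.range a
  have hB' : #B' < κbar := by
    refine (mk_union_le _ _).trans_lt (Cardinal.add_lt_of_lt hκbar hB ?_)
    exact (Cardinal.lt_aleph0_of_finite _).trans_le hκbar
  let φ' : L.Formula (B' ⊕ Fin 1) := φ.relabel
    (Sum.elim (fun b : B => Sum.inl (⟨(b : C), Or.inl b.2⟩ : B'))
      (Sum.elim (fun i => Sum.inl (⟨a i, Or.inr ⟨i, rfl⟩⟩ : B')) Sum.inr))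
  have hφ' : ∀ x : Fin 1 → C, φ'.Realize (Sum.elim (fun b : B' => (b : C)) x) ↔
      φ.Realize (Sum.elim (fun b : B => (b : C)) (Sum.elim a x)) := by
    intro x
    rw [Formula.realize_relabel]
    congr! 1
    ext (i | i | i) <;> rfl
  let up : L.Formula (B ⊕ Fin 1) → L.Formula (B' ⊕ Fin 1) := fun θ =>
    θ.relabel (Sum.map (fun b : B => (⟨(b : C), Or.inl b.2⟩ : B')) id)
  have hup : ∀ (θ : L.Formula (B ⊕ Fin 1)) (x : Fin 1 → C),
      (up θ).Realize (Sum.elim (fun b : B' => (b : C)) x) ↔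
        θ.Realize (Sum.elim (fun b : B => (b : C)) x) := by
    intro θ x
    rw [Formula.realize_relabel]
    congr! 1
    ext (i | i) <;> rfl
  let Γ : Set (L.Formula (B ⊕ Fin 1)) := {θ |
    ∀ᶠ i in (l : Filter ι), θ.Realize (Sum.elim (fun b : B => (b : C)) fun _ => f i)}
  obtain ⟨x, hx⟩ := hC.exists_realize_of_eventually hB' (l : Filter ι) f (up '' Γ ∪ {φ'}) (by
    rintro ψ (⟨θ, hθ, rfl⟩ | rfl)
    · simp only [hup]
      exact hθ
    · simpa only [hφ'] using hφ)
  -- No θ in `Γ` implies φ(a, x), and `Γ` is closed under conjunction; so `Γ` is also consistent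
  -- with ¬φ(a, x).
  obtain ⟨y, hy⟩ := hC.exists_realize hB' (up '' Γ ∪ {φ'.not}) (by
    intro F hF
    obtain ⟨θ, hθ, hθF⟩ : ∃ θ ∈ Γ, ∀ x : Fin 1 → C,
        θ.Realize (Sum.elim (fun b : B => (b : C)) x) →
          ∀ ψ ∈ F, ψ ∈ up '' Γ → ψ.Realize (Sum.elim (fun b : B' => (b : C)) x) := by
      clear hF
      induction F using Finset.induction_on with
      | empty => exact ⟨⊤, by simp [Γ], by simp⟩
      | insert ψ F _ ih =>
        obtain ⟨θ, hθ, hθF⟩ := ih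
        by_cases hψ : ψ ∈ up '' Γ
        · obtain ⟨ρ, hρ, rfl⟩ := hψ
          refine ⟨ρ ⊓ θ, ?_, fun x hx => ?_⟩
          · simp only [Γ, Set.mem_ofPred_eq, Formula.realize_inf]
            exact Filter.Eventually.and hρ hθ
          · rw [Formula.realize_inf] at hx
            intro ψ' h1 h2
            rcases Finset.mem_insert.1 h1 with rfl | h1
            · exact (hup ρ x).2 hx.1
            · exact hθF x hx.2 _ h1 h2
        · refine ⟨θ, hθ, fun x hx ψ' h1 h2 => ?_⟩
          rcases Finset.mem_insert.1 h1 with rfl | h1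
          · exact absurd h2 hψ
          · exact hθF x hx _ h1 h2
    obtain ⟨x, hx, hx'⟩ := hcon θ hθ
    refine ⟨x, fun ψ hψ => ?_⟩
    rcases hF hψ with h1 | h1
    · exact hθF x hx ψ hψ h1
    · rw [Set.mem_singleton_iff.1 h1, Formula.realize_not, hφ']
      exact hx')
  have hxΓ : ∀ θ ∈ Γ, θ.Realize (Sum.elim (fun b : B => (b : C)) x) := fun θ hθ =>
    (hup θ x).1 (hx _ (Or.inl ⟨θ, hθ, rfl⟩))
  have hyΓ : ∀ θ ∈ Γ, θ.Realize (Sum.elim (fun b : B => (b : C)) y) := fun θ hθ =>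
    (hup θ y).1 (hy _ (Or.inl ⟨θ, hθ, rfl⟩))
  have hxφ := (hφ' x).1 (hx _ (Or.inr rfl))
  have hyφ := hy _ (Or.inr rfl)
  rw [Formula.realize_not, hφ'] at hyφ
  -- `Γ` is a complete type because `l` is an ultrafilter. So `x` and `y` realize one nonsplitting
  -- type but disagree on φ(a, ·), against weak orthogonality.
  have hyx : tp L B y = tp L B x := by
    rw [tp_eq_iff]
    intro θ
    rcases l.eventually_or.1 (Filter.Eventually.of_forall fun i => em
      (θ.Realize (Sum.elim (fun b : B => (b : C)) fun _ => f i))) with h | h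
    · exact iff_of_true (hyΓ θ h) (hxΓ θ h)
    · have h' : θ.not ∈ Γ := by simpa only [Γ, Set.mem_ofPred_eq, Formula.realize_not] using h
      exact iff_of_false (Formula.realize_not.1 (hyΓ _ h')) (Formula.realize_not.1 (hxΓ _ h'))
  have hns : tp L B x ∈ nspLT L κ B (Fin 1) :=
    ⟨D, hDB, hDκ, doesNotSplitOver_tp_of_eventually l f hD x hxΓ⟩
  have := ha 1 _ hns a a x y ((realizes_tp_iff _ _).2 rfl) ((realizes_tp_iff _ _).2 rfl)
    ((realizes_tp_iff _ _).2 rfl) ((realizes_tp_iff _ _).2 hyx)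
  exact hyφ (((tp_eq_iff _ _).1 this φ).1 hxφ)

end Orthogonality

/-! ### Definable sets of the expansion as traces. -/

section Expansion

variable {L : FirstOrder.Language.{u, v}} {C : Type w} [L.Structure C]

theorem realize_coe_iff (N : L.ElementarySubstructure C) {α : Type*} (φ : L.Formula α)
    (x : α → N) : φ.Realize (fun i => ((x i : N) : C)) ↔ φ.Realize x :=
  N.subtype.map_formula φ x

/-- The terms of the expansion by new relations are those of the original language. -/
theorem exists_term_realize_eq (N : L.ElementarySubstructure C) (A : Set C) {α : Type*}
    (t : (expansionLanguage L A).Term α) :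
    ∃ s : L.Term α, ∀ x : α → N, s.realize (fun i => ((x i : N) : C)) = ((t.realize x : N) : C) := by
  induction t with
  | var i => exact ⟨Term.var i, fun x => rfl⟩
  | func f ts ih =>
    choose s hs using ih
    rcases f with f | f
    · refine ⟨Term.func f s, fun x => ?_⟩
      simp only [Term.realize, hs]
      exact (N.subtype.map_fun f _).symm
    · exact f.elim

/-- Quantifier free formulas of the expansion define traces of definable sets. -/
theorem exists_formula_of_isQF (N : L.ElementarySubstructure C) (A : Set C) {α : Type*} {k : ℕ}
    (ψ : (expansionLanguage L A).BoundedFormula α k) (hψ : ψ.IsQF) :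
    ∃ φ : L.Formula (A ⊕ (α ⊕ Fin k)), ∀ x : α ⊕ Fin k → N,
      ψ.Realize (x ∘ Sum.inl) (x ∘ Sum.inr) ↔
        φ.Realize (Sum.elim (fun a : A => (a : C)) fun i => ((x i : N) : C)) := by
  induction hψ with
  | falsum => exact ⟨⊥, fun x => Iff.rfl⟩
  | imp _ _ ih₁ ih₂ =>
    obtain ⟨φ₁, h₁⟩ := ih₁
    obtain ⟨φ₂, h₂⟩ := ih₂
    refine ⟨φ₁.imp φ₂, fun x => ?_⟩
    rw [BoundedFormula.realize_imp, Formula.realize_imp, h₁, h₂]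
  | of_isAtomic h =>
    have hsum : ∀ x : α ⊕ Fin k → N, Sum.elim (x ∘ Sum.inl) (x ∘ Sum.inr) = x := fun x =>
      Sum.elim_comp_inl_inr x
    cases h with
    | equal t₁ t₂ =>
      obtain ⟨s₁, h₁⟩ := exists_term_realize_eq N A t₁
      obtain ⟨s₂, h₂⟩ := exists_term_realize_eq N A t₂
      refine ⟨((s₁.relabel Sum.inr).equal (s₂.relabel Sum.inr)), fun x => ?_⟩
      rw [BoundedFormula.realize_bdEqual, Formula.realize_equal, Term.realize_relabel,
        Term.realize_relabel, hsum, Sum.elim_comp_inr, h₁, h₂]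
      exact Subtype.coe_injective.eq_iff.symm
    | @rel j R ts =>
      choose s hs using fun i => exists_term_realize_eq N A (ts i)
      have hrel : ∀ x : α ⊕ Fin k → N,
          (R.boundedFormula ts).Realize (x ∘ Sum.inl) (x ∘ Sum.inr) ↔
            Structure.RelMap R fun i => (ts i).realize x := fun x => by
        rw [BoundedFormula.realize_rel, hsum]
      simp only [hrel]
      clear hrel
      rcases R with R | R
      · refine ⟨R.formula fun i => (s i).relabel Sum.inr, fun x => ?_⟩
        rw [Formula.realize_rel]
        simp only [Term.realize_relabel, Sum.elim_comp_inr, hs]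
        exact (N.subtype.map_rel R _).symm
      -- A new relation symbol is itself an `L`-formula; its arguments are substituted into it.
      · let φ : L.Formula (A ⊕ Fin j) := R
        let t : A ⊕ Fin j → L.Term (A ⊕ (α ⊕ Fin k)) :=
          Sum.elim (fun a => Term.var (Sum.inl a)) fun i => (s i).relabel Sum.inr
        refine ⟨BoundedFormula.subst φ t, fun x => ?_⟩
        have ht : (fun i => (t i).realize
            (Sum.elim (fun a : A => (a : C)) fun i => ((x i : N) : C))) =
              Sum.elim (fun a : A => (a : C)) fun i => (((ts i).realize x : N) : C) := by
          ext (a | i)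
          · rfl
          · simp only [t, Sum.elim_inr, Term.realize_relabel, Sum.elim_comp_inr, hs]
        rw [Formula.Realize, BoundedFormula.realize_subst, ht]
        rfl

/-- If the expansion has elimination of quantifiers, then the sets definable in it are
traces of definable sets. -/
theorem HasQuantifierElimination.exists_formula {N : L.ElementarySubstructure C} {A : Set C}
    (hqe : HasQuantifierElimination (expansionLanguage L A) N) {α : Type*}
    (ψ : (expansionLanguage L A).Formula α) :
    ∃ φ : L.Formula (A ⊕ α), ∀ x : α → N, ψ.Realize x ↔
      φ.Realize (Sum.elim (fun a : A => (a : C)) fun i => ((x i : N) : C)) := by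
  obtain ⟨n, f, ψ₁, h₁⟩ := exists_finite_variables (M := N)
    (ψ.relabel (Sum.inl : α → α ⊕ Empty))
  obtain ⟨ψ₂, hqf, h₂⟩ := hqe n (ψ₁.relabel (Sum.elim id Empty.elim))
  obtain ⟨φ, h₃⟩ := exists_formula_of_isQF N A ψ₂ hqf
  refine ⟨φ.relabel (Sum.map id (Sum.elim f finZeroElim)), fun x => ?_⟩
  have e₁ : ψ.Realize x ↔ ψ₂.Realize (x ∘ f) := by
    rw [← h₂, Formula.realize_relabel]
    have := h₁ x Empty.elim
    rw [Formula.realize_relabel, Sum.elim_comp_inl] at this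
    rw [this]
    congr! 1
    ext (i | i)
    · rfl
    · exact i.elim
  have e₂ := h₃ (x ∘ Sum.elim f finZeroElim)
  rw [Subsingleton.elim ((x ∘ Sum.elim f finZeroElim) ∘ Sum.inr) default] at e₂
  rw [e₁, Formula.realize_relabel]
  refine Iff.trans e₂ ?_
  congr! 1
  ext (i | i | i)
  · rfl
  · rfl
  · exact i.elim0

end Expansion

/-! ### Complete types and their cardinal bounds. -/

section CompleteTypes

/-- A formula in a complete type over a subset of `M` is satisfiable in `M`. -/
theorem exists_realize_of_mem {L : FirstOrder.Language.{u, v}} {M : Type w} [L.Structure M]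
    [Nonempty M] {B : Set M} {α : Type w'} [Finite α] (p : TypesOver L B α)
    {ψ : L[[B]].Formula α} (hψ : Formula.equivSentence ψ ∈ p) : ∃ x : α → M, ψ.Realize x := by
  by_contra! hcon
  obtain ⟨K, v, rfl⟩ := Theory.exists_modelType_is_realized_in _ p
  rw [Theory.CompleteType.formula_mem_typeOf] at hψ
  -- The complete theory of `M` decides ∃x ψ, and `K`, a model of it, satisfies ∃x ψ.
  let σ : L[[B]].Sentence := Formula.iExs α (ψ.relabel (Sum.inr : α → Empty ⊕ α))
  have h₁ : σ.not ∈ L[[B]].completeTheory M := by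
    rw [mem_completeTheory, Sentence.realize_not, Sentence.Realize, Formula.realize_iExs]
    rintro ⟨x, hx⟩
    rw [Formula.realize_relabel, Sum.elim_comp_inr] at hx
    exact hcon x hx
  have h₂ : K ⊨ σ.not := Theory.realize_sentence_of_mem _ h₁
  rw [Sentence.realize_not, Sentence.Realize, Formula.realize_iExs] at h₂
  exact h₂ ⟨v, by rwa [Formula.realize_relabel, Sum.elim_comp_inr]⟩

theorem equivSentence_inf_mem {L : FirstOrder.Language.{u, v}} {M : Type w} [L.Structure M]
    {B : Set M} {α : Type w'} (p : TypesOver L B α) {ψ₁ ψ₂ : L[[B]].Formula α}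
    (h₁ : Formula.equivSentence ψ₁ ∈ p) (h₂ : Formula.equivSentence ψ₂ ∈ p) :
    Formula.equivSentence (ψ₁ ⊓ ψ₂) ∈ p := by
  obtain ⟨K, v, rfl⟩ := Theory.exists_modelType_is_realized_in _ p
  rw [Theory.CompleteType.formula_mem_typeOf] at *
  exact Formula.realize_inf.2 ⟨h₁, h₂⟩

/-- A tuple satisfying all formulas of a complete type realizes it. -/
theorem realizes_of_forall_mem {L : FirstOrder.Language.{u, v}} {M : Type w} [L.Structure M]
    {B : Set M} {α : Type w'} (p : TypesOver L B α) (x : α → M)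
    (h : ∀ ψ : L[[B]].Formula α, Formula.equivSentence ψ ∈ p → ψ.Realize x) : Realizes x p := by
  refine fun ψ => ⟨h ψ, fun hx => by_contra fun hn => ?_⟩
  have : Formula.equivSentence ψ.not ∈ p := (p.not_mem_iff _).2 hn
  exact Formula.realize_not.1 (h _ this) hx

theorem mk_range_lt_of_mk_lt {ι : Type max u v w} {X : Type w} (f : ι → X) {κ : Cardinal.{w}}
    (h : #ι < Cardinal.lift.{max u v} κ) : #(Set.range f) < κ := by
  have h₁ := Cardinal.mk_range_le_lift (f := f)
  rw [Cardinal.lift_id'.{w, max u v w}] at h₁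
  rw [← Cardinal.lift_lt.{w, max u v w}]
  exact h₁.trans_lt (h.trans_eq (congrFun Cardinal.lift_umax.{w, max u v} κ).symm)

end CompleteTypes

end ExternalExpansion

/-! ### Saturation of the expansion. -/

theorem mainTheorem9 {L : FirstOrder.Language.{u, v}} (T : L.Theory) (hT : T.IsComplete)
    (hdep : ExternalExpansion.IsDependent T)
    (κ : Cardinal.{w}) (hκ : Cardinal.lift.{w} (max ℵ₀ L.card) < Cardinal.lift.{max u v} κ)
    -- the monster model
    (C : Type w) [L.Structure C] [Nonempty C] [C ⊨ T]
    (κbar : Cardinal.{w}) (hκbar : ℵ₀ ≤ κbar) (hC : ExternalExpansion.IsSaturated L κbar C)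
    (N : L.ElementarySubstructure C) (hNC : #N < κbar)
    (hN : ExternalExpansion.IsSaturated L κ N)
    (A : Set C) (hA : #A < κ)
    (horth : ∀ (n : ℕ) (a : Fin n → C), (∀ i, a i ∈ A) →
      ExternalExpansion.tp L (N : Set C) a ∈
        ExternalExpansion.nspGE L κ (N : Set C) (Fin n))
    (hqe : ExternalExpansion.HasQuantifierElimination
      (ExternalExpansion.expansionLanguage L A) N) :
    ExternalExpansion.IsSaturated (ExternalExpansion.expansionLanguage L A) κ N := by
  open FirstOrder.Language ExternalExpansion Filter in
  classical
  intro B hB p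
  have hℵκ : ℵ₀ < κ := by
    rw [← Cardinal.lift_lt.{w, max u v}, Cardinal.lift_aleph0]
    refine lt_of_le_of_lt ?_ hκ
    rw [← Cardinal.lift_aleph0.{w, max u v}, Cardinal.lift_le]
    exact le_max_left _ _
  let Holds : L.Formula (A ⊕ (B ⊕ Fin 1)) → (Fin 1 → N) → Prop := fun φ x =>
    φ.Realize (Sum.elim (fun a : A => (a : C)) fun i =>
      ((Sum.elim (fun b : B => (b : N)) x i : N) : C))
  have htrace : ∀ ψ : (expansionLanguage L A)[[B]].Formula (Fin 1),
      ∃ φ, ∀ x : Fin 1 → N, ψ.Realize x ↔ Holds φ x := fun ψ => by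
    obtain ⟨φ, hφ⟩ := hqe.exists_formula (BoundedFormula.constantsVarsEquiv ψ)
    exact ⟨φ, fun x => by rw [← realize_constantsVarsEquiv_iff, hφ]⟩
  let P : Set (L.Formula (A ⊕ (B ⊕ Fin 1))) := {φ |
    ∃ ψ : (expansionLanguage L A)[[B]].Formula (Fin 1),
    Formula.equivSentence ψ ∈ p ∧ ∀ x, ψ.Realize x ↔ Holds φ x}
  suffices hP : ∃ x : Fin 1 → N, ∀ φ ∈ P, Holds φ x by
    obtain ⟨x, hx⟩ := hP
    refine ⟨x, realizes_of_forall_mem p x fun ψ hψ => ?_⟩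
    obtain ⟨φ, hφ⟩ := htrace ψ
    exact (hφ x).2 (hx φ ⟨ψ, hψ, hφ⟩)
  have hPκ : #P < Cardinal.lift.{max u v} κ := by
    refine (Cardinal.mk_set_le P).trans_lt (mk_formula_lt hκ ?_)
    rw [Cardinal.mk_sum, Cardinal.mk_sum]
    simp only [Cardinal.lift_uzero, Cardinal.lift_id]
    refine Cardinal.add_lt_of_lt hℵκ.le hA (Cardinal.add_lt_of_lt hℵκ.le hB ?_)
    simpa using Cardinal.one_lt_aleph0.trans hℵκ
  have hex : ∀ φ : P, ∃ x : N, Holds φ fun _ => x := by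
    rintro ⟨φ, ψ, hψ, hφ⟩
    obtain ⟨x, hx⟩ := exists_realize_of_mem p hψ
    refine ⟨x 0, ?_⟩
    rw [← hφ]
    convert hx using 1
    ext i
    rw [Subsingleton.elim i 0]
  choose g hg using hex
  have hconj : ∀ F : Finset P, ∃ φ : P, ∀ x, Holds φ x → ∀ φ' ∈ F, Holds φ' x := by
    intro F
    induction F using Finset.induction_on with
    | empty =>
      obtain ⟨φ, hφ⟩ := htrace ⊤
      refine ⟨⟨φ, ⊤, ?_, hφ⟩, by simp⟩
      obtain ⟨K, v, rfl⟩ := Theory.exists_modelType_is_realized_in _ p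
      rw [Theory.CompleteType.formula_mem_typeOf]
      exact Formula.realize_top.2 trivial
    | insert φ F _ ih =>
      obtain ⟨φ₂, h⟩ := ih
      obtain ⟨ψ, hψ, hφ⟩ := φ.2
      obtain ⟨ψ₂, hψ₂, hφ₂⟩ := φ₂.2
      refine ⟨⟨φ.1 ⊓ φ₂.1, ψ ⊓ ψ₂, equivSentence_inf_mem p hψ hψ₂, fun x => ?_⟩, fun x hx => ?_⟩
      · simp only [Holds] at hφ hφ₂ ⊢
        rw [Formula.realize_inf, Formula.realize_inf, hφ, hφ₂]
      · have hx' := Formula.realize_inf.1 hx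
        intro φ' hφ'
        rcases Finset.mem_insert.1 hφ' with rfl | hφ'
        · exact hx'.1
        · exact h x hx'.2 φ' hφ'
  choose k hk using hconj
  -- `f F` satisfies every formula in `F`, and `l` contains all tails, so each formula of `P` holds
  -- `l`-almost everywhere.
  let l : Ultrafilter (Finset P) := Ultrafilter.of atTop
  let f : Finset P → N := fun F => g (k F)
  have hl : ∀ φ : P, ∀ᶠ F in (l : Filter (Finset P)), Holds φ fun _ => f F := fun φ => by
    filter_upwards [Ultrafilter.of_le atTop (eventually_ge_atTop {φ})] with F hF
    exact hk F _ (hg _) φ (hF (Finset.mem_singleton_self φ))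
  -- All values of `f` lie in `D`, and |D| ≤ |P| < κ.
  let D : Set C := Set.range fun φ : P => (g φ : C)
  have hDN : D ⊆ (N : Set C) := by
    rintro _ ⟨φ, rfl⟩
    exact (g φ).2
  have hDκ : #D < κ := mk_range_lt_of_mk_lt.{u, v} _ hPκ
  have hθ : ∀ φ : P, ∃ (m : ℕ) (e : Fin m → N) (θ : L.Formula (Fin m ⊕ Fin 1)),
      (∀ᶠ F in (l : Filter (Finset P)), θ.Realize (Sum.elim e fun _ => f F)) ∧
      ∀ x : Fin 1 → N, θ.Realize (Sum.elim e x) → Holds φ x := by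
    intro φ
    obtain ⟨n, a, φ₁, hφ₁⟩ := exists_finite_variables (M := C) φ.1
    let φ₂ : L.Formula ((N : Set C) ⊕ (Fin n ⊕ Fin 1)) := φ₁.relabel
      (Sum.elim (fun i => Sum.inr (Sum.inl i))
        (Sum.elim (fun b : B => Sum.inl (b : N)) fun i => Sum.inr (Sum.inr i)))
    have hφ₂ : ∀ x : Fin 1 → N, Holds φ x ↔ φ₂.Realize
        (Sum.elim (fun b : (N : Set C) => (b : C))
          (Sum.elim (fun i => (a i : C)) fun i => ((x i : N) : C))) := by
      intro x
      simp only [Holds]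
      rw [hφ₁, Formula.realize_relabel]
      congr! 1
      ext (i | i | i) <;> rfl
    obtain ⟨θ, hθl, hθ⟩ := exists_formula_imp_of_eventually hκbar hC (B := (N : Set C)) hNC
      (fun i => (a i : C)) (horth n _ fun i => (a i).2) hDN hDκ l (fun F => (f F : C))
      (Filter.Eventually.of_forall fun F => ⟨k F, rfl⟩) φ₂
      ((hl φ).mono fun F hF => (hφ₂ _).1 hF)
    obtain ⟨m, e, θ', hθ'⟩ := exists_finite_variables (M := C) θ
    have hθN : ∀ x : Fin 1 → N, θ'.Realize (M := N) (Sum.elim (fun i => (e i : N)) x) ↔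
        θ.Realize (Sum.elim (fun b : (N : Set C) => (b : C)) fun i => ((x i : N) : C)) := by
      intro x
      rw [hθ', ← realize_coe_iff]
      congr! 1
      ext (i | i) <;> rfl
    refine ⟨m, fun i => e i, θ', ?_, fun x hx => ?_⟩
    · filter_upwards [hθl] with F hF
      exact (hθN _).2 hF
    · exact (hφ₂ x).2 (hθ _ ((hθN x).1 hx))
  choose m e θ hθl hθ using hθ
  -- Finitely many parameters for each of fewer than κ formulas, with κ uncountable.
  let E : Set N := Set.range fun i : (φ : P) × Fin (m φ) => e i.1 i.2
  have hEκ : #E < κ := by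
    refine mk_range_lt_of_mk_lt.{u, v} _ ?_
    have hℵ : ℵ₀ ≤ Cardinal.lift.{max u v} κ := by
      rw [← Cardinal.lift_aleph0.{max u v, w}, Cardinal.lift_le]
      exact hℵκ.le
    have hsig : #((φ : P) × Fin (m φ)) ≤ #(P × ℕ) :=
      Cardinal.mk_le_of_injective (f := fun i => (i.1, (i.2 : ℕ))) (by
        rintro ⟨φ, i⟩ ⟨φ', i'⟩ h
        obtain ⟨h₁, h₂⟩ := Prod.mk.inj h
        dsimp only at h₁ h₂
        subst h₁
        rw [Fin.ext h₂])
    refine hsig.trans_lt ?_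
    rw [Cardinal.mk_prod, Cardinal.lift_uzero, Cardinal.mk_nat, Cardinal.lift_aleph0]
    refine Cardinal.mul_lt_of_lt hℵ hPκ ?_
    rw [← Cardinal.lift_aleph0.{max u v, w}, Cardinal.lift_lt]
    exact hℵκ
  let θE : P → L.Formula (E ⊕ Fin 1) := fun φ =>
    (θ φ).relabel (Sum.map (fun i => (⟨e φ i, ⟨φ, i⟩, rfl⟩ : E)) id)
  have hθE : ∀ (φ : P) (x : Fin 1 → N), (θE φ).Realize (Sum.elim (fun b : E => (b : N)) x) ↔
      (θ φ).Realize (Sum.elim (e φ) x) := by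
    intro φ x
    rw [Formula.realize_relabel]
    congr! 1
    ext (i | i) <;> rfl
  -- Finite satisfiability in `N` is witnessed by the values of `f`.
  obtain ⟨x, hx⟩ := hN.exists_realize_of_eventually hEκ (l : Filter (Finset P)) f (Set.range θE) (by
    rintro _ ⟨φ, rfl⟩
    simpa only [hθE] using hθl φ)
  exact ⟨x, fun φ hφ => hθ ⟨φ, hφ⟩ x ((hθE _ x).1 (hx _ ⟨_, rfl⟩))⟩
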